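/- Let $X$ be a nonzero real Banach space with closed unit ball $B_X$ and unit sphere $S_X$. For $x^*\in S_{X^*}$ and $\varepsilon>0$ write $S(x^*,\varepsilon)=\{x\in B_X : x^*(x)>1-\varepsilon\}$. Suppose that $X$ has the local diameter 2 property+ (LD2P+), that is, for every $x^*\in S_{X^*}$, every $\varepsilon>0$, every $\delta>0$ and every $x\in S(x^*,\varepsilon)\cap S_X$ there exists $y\in S(x^*,\varepsilon)$ with $\|x-y\|>2-\delta$. Then the bidual $X^{**}$ is not smooth, that is, it is not the case that for every $x^{**}\in S_{X^{**}}$ there is exactly one $x^{***}\in S_{X^{***}}$ with $x^{***}(x^{**})=1$. -/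

import Mathlib

/-- The slice `S(f, ε) = {x ∈ B_X : f(x) > 1 - ε}` of the closed unit ball determined by the
functional `f` and `ε`; it is used for `‖f‖ = 1` and `ε > 0` only. -/
def ballSlice {X : Type*} [NormedAddCommGroup X] [NormedSpace ℝ X]
    (f : StrongDual ℝ X) (ε : ℝ) : Set X :=
  {x | x ∈ Metric.closedBall (0 : X) 1 ∧ 1 - ε < f x}

/-- The local diameter 2 property+: for every slice of the unit ball and every norm-one point `x`
of it, the slice contains points whose distance to `x` is as close to 2 as we want. -/
def HasLD2PPlus (X : Type*) [NormedAddCommGroup X] [NormedSpace ℝ X] : Prop :=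
  ∀ f ∈ Metric.sphere (0 : StrongDual ℝ X) 1, ∀ ε : ℝ, 0 < ε → ∀ δ : ℝ, 0 < δ →
    ∀ x ∈ ballSlice f ε ∩ Metric.sphere (0 : X) 1, ∃ y ∈ ballSlice f ε, 2 - δ < ‖x - y‖

/-- The norm of `X` is smooth: each norm-one vector has exactly one norm-one functional that takes
the value 1 at it. -/
def IsSmoothSpace (X : Type*) [NormedAddCommGroup X] [NormedSpace ℝ X] : Prop :=
  ∀ x ∈ Metric.sphere (0 : X) 1,
    ∃! f : StrongDual ℝ X, f ∈ Metric.sphere (0 : StrongDual ℝ X) 1 ∧ f x = 1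

/-! If `X**` is smooth and `f` supports `x`, then `f`, viewed in `X***`, is the only support
functional of `x` in `X**`. Hence functionals `f_n` supporting points `u_n → x` converge weakly to
`f`, and `f` lies in their norm-closed convex hull (`IsSmoothSpace.mem_closure_convexHull`). The
LD2P+ contradicts this. Replacing `x` by the normalization of `x - t y`, with `y` in a slice given
by `a` and almost opposite to `x`, forces later support functionals to be negative at `y`, hence far
from `a` (`HasLD2PPlus.exists_perturbation`). Convex hulls of finitely many functionals are
separable, so countably many rapidly shrinking moves avoid them all
(`HasLD2PPlus.exists_seq_support_separated`). -/

open Filter Topology Set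

/-- If the dual of `Y` is smooth and `ξ` attains its norm at `y`, then every sequence in the unit
ball of `Y` along which `ξ` tends to its norm has `y` in its closed convex hull. -/
theorem IsSmoothSpace.mem_closure_convexHull {Y : Type*} [NormedAddCommGroup Y] [NormedSpace ℝ Y]
    (hY : IsSmoothSpace (StrongDual ℝ Y)) {ξ : StrongDual ℝ Y} (hξ : ‖ξ‖ = 1) {y : Y}
    (hy : ‖y‖ = 1) (hξy : ξ y = 1) {g : ℕ → Y} (hg : ∀ n, ‖g n‖ ≤ 1)
    (hgξ : Tendsto (fun n => ξ (g n)) atTop (𝓝 1)) :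
    y ∈ closure (convexHull ℝ (range g)) := by
  by_contra hmem
  obtain ⟨φ, s, hφy, hφ⟩ := geometric_hahn_banach_point_closed
    (convex_convexHull ℝ (range g)).closure isClosed_closure hmem
  let G : ℕ → WeakDual ℝ (StrongDual ℝ Y) := fun n =>
    StrongDual.toWeakDual (NormedSpace.inclusionInDoubleDual ℝ Y (g n))
  have hG : ∀ n, G n ∈ WeakDual.toStrongDual ⁻¹'
      Metric.closedBall (0 : StrongDual ℝ (StrongDual ℝ Y)) 1 := fun n =>
    (mem_closedBall_zero_iff (E := StrongDual ℝ (StrongDual ℝ Y))).2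
      ((NormedSpace.double_dual_bound ℝ Y (g n)).trans (hg n))
  -- The bidual ball need not be weak* sequentially compact, so the limit is taken along a
  -- nonprincipal ultrafilter.
  obtain ⟨F, hFmem, hF⟩ := (WeakDual.isCompact_closedBall
    (0 : StrongDual ℝ (StrongDual ℝ Y)) 1).ultrafilter_le_nhds
      ((hyperfilter ℕ).map G) (le_principal_iff.2 (Filter.mem_map.2 (univ_mem' hG)))
  have hlim : ∀ ψ : StrongDual ℝ Y,
      Tendsto (fun n => ψ (g n)) (hyperfilter ℕ) (𝓝 (F ψ)) := fun ψ =>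
    ((WeakDual.eval_continuous ψ).tendsto F).comp hF
  have hFξ : WeakDual.toStrongDual F ξ = 1 :=
    tendsto_nhds_unique (hlim ξ) (hgξ.mono_left Nat.hyperfilter_le_atTop)
  have hFle : ‖WeakDual.toStrongDual F‖ ≤ 1 := mem_closedBall_zero_iff.1 hFmem
  have hFge : 1 ≤ ‖WeakDual.toStrongDual F‖ := by
    have h1 := (WeakDual.toStrongDual F).le_opNorm ξ
    rwa [hFξ, norm_one, hξ, mul_one] at h1
  have hJy : ‖NormedSpace.inclusionInDoubleDual ℝ Y y‖ = 1 :=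
    ((NormedSpace.inclusionInDoubleDualLi ℝ (E := Y)).norm_map y).trans hy
  have hFφ : F φ = φ y :=
    congrArg (fun H : StrongDual ℝ (StrongDual ℝ Y) => H φ)
      ((hY ξ (mem_sphere_zero_iff_norm.2 hξ)).unique
        ⟨mem_sphere_zero_iff_norm.2 (le_antisymm hFle hFge), hFξ⟩
        ⟨mem_sphere_zero_iff_norm.2 hJy, hξy⟩)
  have : s ≤ F φ := ge_of_tendsto' (hlim φ) fun n =>
    (hφ _ (subset_closure (subset_convexHull ℝ _ (mem_range_self n)))).le
  linarith

/-- In a space with the LD2P+ one can move a norm-one point slightly so that every functional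
almost supporting the new point is far from a given functional almost supporting the old one. -/
theorem HasLD2PPlus.exists_perturbation {X : Type*} [NormedAddCommGroup X] [NormedSpace ℝ X]
    (hX : HasLD2PPlus X) {t : ℝ} (ht : 0 < t) (ht1 : t ≤ 1) {x : X} (hx : ‖x‖ = 1)
    {a : StrongDual ℝ X} (ha : ‖a‖ ≤ 1) (hax : 3 / 4 < a x) :
    ∃ x' : X, ‖x'‖ = 1 ∧ ‖x - x'‖ ≤ 2 * t ∧
      ∀ h : StrongDual ℝ X, ‖h‖ ≤ 1 → 1 - t / 8 ≤ h x' → 1 ≤ ‖a - h‖ := by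
  have ha0 : 3 / 4 < ‖a‖ := by
    have := a.le_opNorm x
    rw [hx, mul_one, Real.norm_eq_abs] at this
    linarith [le_abs_self (a x)]
  have hpos : 0 < ‖a‖ := by linarith
  have hb : ‖‖a‖⁻¹ • a‖ = 1 := by
    rw [norm_smul, norm_inv, norm_norm, inv_mul_cancel₀ hpos.ne']
  have hbx : 1 - 1 / 4 < (‖a‖⁻¹ • a) x := by
    have : 1 ≤ ‖a‖⁻¹ := (one_le_inv₀ hpos).2 ha
    simp only [smul_apply, smul_eq_mul]
    nlinarith
  obtain ⟨y, ⟨hy, hby⟩, hxy⟩ := hX (‖a‖⁻¹ • a) (mem_sphere_zero_iff_norm.2 hb) (1 / 4)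
    (by norm_num) (t / 4) (by positivity) x
    ⟨⟨mem_closedBall_zero_iff.2 hx.le, hbx⟩, mem_sphere_zero_iff_norm.2 hx⟩
  rw [mem_closedBall_zero_iff] at hy
  have hay : 1 / 2 ≤ a y := by
    simp only [smul_apply, smul_eq_mul] at hby
    rw [inv_mul_eq_div, lt_div_iff₀ hpos] at hby
    linarith
  set z := x - t • y with hz
  have hty : ‖t • y‖ ≤ t := by
    rw [norm_smul, Real.norm_of_nonneg ht.le]
    exact mul_le_of_le_one_right ht.le hy
  have hzle : ‖z‖ ≤ 1 + t := (norm_sub_le _ _).trans (by linarith)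
  -- Since `x - y = z - (1 - t) y`, the near-maximal distance from `x` to `y` makes `z` almost as
  -- long as possible.
  have hzge : 1 + t - t / 4 ≤ ‖z‖ := by
    have h1 : x - y = z - (1 - t) • y := by rw [hz]; module
    have h2 : ‖(1 - t) • y‖ ≤ 1 - t := by
      rw [norm_smul, Real.norm_of_nonneg (by linarith)]
      exact mul_le_of_le_one_right (by linarith) hy
    have h3 : ‖x - y‖ ≤ ‖z‖ + ‖(1 - t) • y‖ := h1 ▸ norm_sub_le _ _
    linarith
  have hz0 : 0 < ‖z‖ := by linarith
  refine ⟨‖z‖⁻¹ • z, ?_, ?_, fun h hh hhx => ?_⟩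
  · rw [norm_smul, norm_inv, norm_norm, inv_mul_cancel₀ hz0.ne']
  · have h1 : x - ‖z‖⁻¹ • z = t • y + (1 - ‖z‖⁻¹) • z := by rw [hz]; module
    have h2 : ‖(1 - ‖z‖⁻¹) • z‖ = ‖z‖ - 1 := by
      rw [norm_smul, Real.norm_of_nonneg (sub_nonneg.2 (inv_le_one_of_one_le₀ (by linarith))),
        sub_mul, inv_mul_cancel₀ hz0.ne', one_mul]
    rw [h1]
    exact (norm_add_le _ _).trans (by rw [h2]; linarith)
  · have hhX : h x ≤ 1 := by
      have := h.le_of_opNorm_le hh x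
      rw [hx, Real.norm_eq_abs] at this
      linarith [le_abs_self (h x)]
    have hhz : (1 - t / 8) * ‖z‖ ≤ h x - t * h y := by
      rw [map_smul, smul_eq_mul, inv_mul_eq_div, le_div_iff₀ hz0, hz, map_sub, map_smul,
        smul_eq_mul] at hhx
      exact hhx
    -- As `t ≤ 1`, `(1 - t/8)(1 + 3t/4) ≥ 1 + t/2`, while `h x ≤ 1`.
    have hhy : h y ≤ -(1 / 2) := by
      have h1 : (1 - t / 8) * (1 + t - t / 4) ≤ (1 - t / 8) * ‖z‖ :=
        mul_le_mul_of_nonneg_left hzge (by linarith)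
      have h2 : t * h y ≤ t * -(1 / 2) := by nlinarith
      exact le_of_mul_le_mul_left h2 ht
    have h1 := (a - h).le_opNorm y
    rw [sub_apply, Real.norm_eq_abs] at h1
    have h2 : ‖a - h‖ * ‖y‖ ≤ ‖a - h‖ := mul_le_of_le_one_right (norm_nonneg _) hy
    linarith [le_abs_self (a y - h y)]

/-- Recursive construction of a sequence whose next term depends on all earlier ones. -/
theorem exists_seq_of_history {α : Type*} (x₀ : α) (G : ℕ → (ℕ → α) → α)
    (hG : ∀ n u v, (∀ i ≤ n, u i = v i) → G n u = G n v) :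
    ∃ u : ℕ → α, u 0 = x₀ ∧ ∀ n, u (n + 1) = G n u := by
  -- The state is a whole sequence, final up to index `n` and equal to `x₀` beyond; `hG` makes these
  -- defaults harmless.
  let c : ℕ → ℕ → α := fun n =>
    Nat.rec (fun _ => x₀) (fun k v => Function.update v (k + 1) (G k v)) n
  have hc : ∀ n, c (n + 1) = Function.update (c n) (n + 1) (G n (c n)) := fun _ => rfl
  have hstab : ∀ i n, i ≤ n → c n i = c i i := fun i n hin => by
    induction n, hin using Nat.le_induction with
    | base => rfl
    | succ n hin ih => rw [hc, Function.update_of_ne (by omega), ih]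
  refine ⟨fun n => c n n, rfl, fun n => ?_⟩
  change c (n + 1) (n + 1) = _
  rw [hc, Function.update_self]
  exact hG _ _ _ fun i hi => hstab i n hi

theorem TopologicalSpace.IsSeparable.exists_seq_mem_dense {α : Type*} [PseudoMetricSpace α]
    {s : Set α} (hs : IsSeparable s) (hne : s.Nonempty) :
    ∃ d : ℕ → α, (∀ j, d j ∈ s) ∧ s ⊆ closure (range d) := by
  have := hs.separableSpace
  have := hne.to_subtype
  refine ⟨fun j => denseSeq s j, fun j => (denseSeq s j).2, fun y hy => ?_⟩
  have h := image_closure_subset_closure_image continuous_subtype_val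
    (mem_image_of_mem Subtype.val (denseRange_denseSeq s ⟨y, hy⟩))
  rwa [← range_comp] at h

theorem convexHull_range_subset_iUnion {E : Type*} [AddCommGroup E] [Module ℝ E] (g : ℕ → E) :
    convexHull ℝ (range g) ⊆ ⋃ k, convexHull ℝ (g '' Iic k) := by
  refine convexHull_min ?_ (Directed.convex_iUnion ?_ fun _ => convex_convexHull ℝ _)
  · rintro _ ⟨k, rfl⟩
    exact mem_iUnion.2 ⟨k, subset_convexHull ℝ _ (mem_image_of_mem g self_mem_Iic)⟩
  · exact Monotone.directed_le fun i j hij =>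
      convexHull_mono (image_mono (Iic_subset_Iic.2 hij))

/-- In a Banach space with the LD2P+, for every choice `D` of supporting functionals there is a
convergent sequence in the unit sphere such that the supporting functionals of the limit stay away
from the convex hull of the functionals chosen along the sequence. -/
theorem HasLD2PPlus.exists_seq_support_separated {X : Type*} [NormedAddCommGroup X]
    [NormedSpace ℝ X] [CompleteSpace X] [Nontrivial X] (hX : HasLD2PPlus X)
    {D : X → StrongDual ℝ X} (hD : ∀ x, ‖D x‖ = 1) (hDx : ∀ x, D x x = ‖x‖) :
    ∃ (u : ℕ → X) (x : X), Tendsto u atTop (𝓝 x) ∧ (∀ n, ‖u n‖ = 1) ∧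
      ∀ f : StrongDual ℝ X, ‖f‖ ≤ 1 → f x = 1 →
        f ∉ closure (convexHull ℝ (range fun n => D (u n))) := by
  let C : ℕ → (ℕ → X) → Set (StrongDual ℝ X) := fun k u =>
    convexHull ℝ ((fun i => D (u i)) '' Iic k)
  have hdense : ∀ s : Set (StrongDual ℝ X), ∃ d : ℕ → StrongDual ℝ X,
      TopologicalSpace.IsSeparable s → s.Nonempty →
        (∀ j, d j ∈ s) ∧ s ⊆ closure (range d) := fun s => by
    by_cases h : TopologicalSpace.IsSeparable s ∧ s.Nonempty
    · obtain ⟨d, hd⟩ := h.1.exists_seq_mem_dense h.2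
      exact ⟨d, fun _ _ => hd⟩
    · exact ⟨0, fun h1 h2 => (h ⟨h1, h2⟩).elim⟩
  choose d hd using hdense
  -- With `n = pair k j`, step `n` treats the `j`-th dense point of the `k`-th hull. Since `k ≤ n`,
  -- that hull is already determined.
  let A : ℕ → (ℕ → X) → StrongDual ℝ X := fun n u => d (C n.unpair.1 u) n.unpair.2
  -- The ratio 1/32 keeps all movement after step `n` below `t n / 8`, the tolerance of the
  -- perturbation lemma.
  let t : ℕ → ℝ := fun n => 1 / 32 * (1 / 32) ^ n
  have ht : ∀ n, 0 < t n := fun n => by positivity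
  have ht1 : ∀ n, t n ≤ 1 / 32 := fun n =>
    mul_le_of_le_one_right (by norm_num) (pow_le_one₀ (by norm_num) (by norm_num))
  have hstep : ∀ (n : ℕ) (x : X) (a : StrongDual ℝ X), ∃ x' : X, ‖x‖ = 1 →
      ‖x'‖ = 1 ∧ ‖x - x'‖ ≤ 2 * t n ∧ (‖a‖ ≤ 1 → 3 / 4 < a x →
        ∀ h : StrongDual ℝ X, ‖h‖ ≤ 1 → 1 - t n / 8 ≤ h x' → 1 ≤ ‖a - h‖) := fun n x a => by
    by_cases h : ‖x‖ = 1 ∧ ‖a‖ ≤ 1 ∧ 3 / 4 < a x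
    · obtain ⟨x', h1, h2, h3⟩ :=
        hX.exists_perturbation (ht n) ((ht1 n).trans (by norm_num)) h.1 h.2.1 h.2.2
      exact ⟨x', fun _ => ⟨h1, h2, fun _ _ => h3⟩⟩
    · refine ⟨x, fun hx => ⟨hx, ?_, fun h1 h2 => (h ⟨hx, h1, h2⟩).elim⟩⟩
      rw [sub_self, norm_zero]
      linarith [ht n]
  choose T hT using hstep
  obtain ⟨x₀, hx₀⟩ := exists_norm_eq X zero_le_one
  obtain ⟨u, hu0, hu⟩ := exists_seq_of_history x₀ (fun n u => T n (u n) (A n u))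
    fun n u v huv => by
      have hC : C n.unpair.1 u = C n.unpair.1 v := congrArg (convexHull ℝ) <|
        image_congr fun i hi => by rw [huv i (le_trans hi n.unpair_left_le)]
      simp only [A, hC, huv n le_rfl]
  have hu1 : ∀ n, ‖u n‖ = 1 := fun n => by
    induction n with
    | zero => rw [hu0, hx₀]
    | succ n ih => rw [hu]; exact (hT n _ _ ih).1
  have hudist : ∀ n, dist (u n) (u (n + 1)) ≤ 1 / 16 * (1 / 32) ^ n := fun n => by
    rw [dist_eq_norm, hu]
    refine (hT n _ _ (hu1 n)).2.1.trans (le_of_eq ?_)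
    simp only [t]
    ring
  obtain ⟨x, hx⟩ := cauchySeq_tendsto_of_complete
    (cauchySeq_of_le_geometric (1 / 32 : ℝ) (1 / 16) (by norm_num) hudist)
  have hlim : ∀ n, ‖u n - x‖ ≤ 2 / 31 * (1 / 32) ^ n := fun n => by
    rw [← dist_eq_norm]
    refine (dist_le_of_le_geometric_of_tendsto _ _ (by norm_num) hudist hx n).trans (le_of_eq ?_)
    ring
  have hclose : ∀ i j, ‖u i - u j‖ < 1 / 4 := fun i j => by
    have h : ∀ n, ‖u n - x‖ < 1 / 8 := fun n => by
      have : (1 / 32 : ℝ) ^ n ≤ 1 := pow_le_one₀ (by norm_num) (by norm_num)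
      linarith [hlim n]
    have := norm_sub_le_norm_sub_add_norm_sub (u i) x (u j)
    rw [norm_sub_rev x] at this
    linarith [h i, h j]
  have heval : ∀ (f : StrongDual ℝ X) (y z : X), ‖f‖ ≤ 1 → f y - f z ≤ ‖y - z‖ :=
    fun f y z hf => by
      have := f.le_of_opNorm_le hf (y - z)
      rw [one_mul, map_sub, Real.norm_eq_abs] at this
      exact (le_abs_self _).trans this
  have hCsep : ∀ k, TopologicalSpace.IsSeparable (C k u) := fun k =>
    (((finite_Iic k).image _).isCompact_convexHull ℝ).isSeparable
  have hCne : ∀ k, (C k u).Nonempty := fun k =>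
    ((nonempty_Iic (a := k)).image _).convexHull
  -- All `u i` lie within 1/4 of each other, so every hull element is admissible for a perturbation
  -- at every `u n`.
  have hCsub : ∀ k n, C k u ⊆ {a | ‖a‖ ≤ 1 ∧ 3 / 4 < a (u n)} := fun k n => by
    have hconv : Convex ℝ {a : StrongDual ℝ X | ‖a‖ ≤ 1 ∧ 3 / 4 < a (u n)} := by
      have h1 := convex_closedBall (0 : StrongDual ℝ X) 1
      have h2 : Convex ℝ {a : StrongDual ℝ X | 3 / 4 < a (u n)} :=
        convex_halfSpace_gt ⟨fun _ _ => rfl, fun _ _ => rfl⟩ _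
      convert! h1.inter h2 using 1
      ext a
      simp
    refine convexHull_min ?_ hconv
    rintro _ ⟨i, -, rfl⟩
    refine ⟨(hD _).le, ?_⟩
    have h1 := heval (D (u i)) (u i) (u n) (hD _).le
    rw [hDx, hu1] at h1
    linarith [hclose i n]
  refine ⟨u, x, hx, hu1, fun f hf hfx hmem => ?_⟩
  -- Two approximations within 1/2 put `f` at distance less than 1 from a treated dense point.
  obtain ⟨a, ha, hfa⟩ := Metric.mem_closure_iff.1 hmem (1 / 2) (by norm_num)
  obtain ⟨k, hk⟩ := mem_iUnion.1 (convexHull_range_subset_iUnion _ ha)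
  obtain ⟨_, ⟨j, rfl⟩, haj⟩ := Metric.mem_closure_iff.1
    ((hd _ (hCsep k) (hCne k)).2 hk) (1 / 2) (by norm_num)
  have hA : A (Nat.pair k j) u = d (C k u) j := by simp only [A, Nat.unpair_pair]
  have hAmem := hCsub k (Nat.pair k j) ((hd _ (hCsep k) (hCne k)).1 j)
  have hfar := (hT (Nat.pair k j) (u (Nat.pair k j)) (A (Nat.pair k j) u) (hu1 _)).2.2
  rw [hA] at hfar
  have := hfar hAmem.1 hAmem.2 f hf <| by
    have h1 := heval f x (u (Nat.pair k j + 1)) hf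
    have h2 := hlim (Nat.pair k j + 1)
    have h3 : (0 : ℝ) < (1 / 32) ^ Nat.pair k j := by positivity
    have h4 : T (Nat.pair k j) (u (Nat.pair k j)) (d (C k u) j) = u (Nat.pair k j + 1) := by
      rw [hu, hA]
    rw [norm_sub_rev, pow_succ] at h2
    rw [h4]
    simp only [t]
    linarith
  rw [← dist_eq_norm, dist_comm] at this
  linarith [dist_triangle f a (d (C k u) j)]

theorem corollary3p7 (X : Type*) [NormedAddCommGroup X] [NormedSpace ℝ X] [CompleteSpace X]
    [Nontrivial X] (hX : HasLD2PPlus X) :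
    ¬ IsSmoothSpace (StrongDual ℝ (StrongDual ℝ X)) := by
  intro hsm
  choose D hD hDx using fun x : X => exists_dual_vector' ℝ x
  obtain ⟨u, x, hux, hu, hsep⟩ := hX.exists_seq_support_separated hD fun x => by simpa using hDx x
  have hx : ‖x‖ = 1 :=
    tendsto_nhds_unique hux.norm (by simpa only [hu] using tendsto_const_nhds)
  have hDxx : D x x = 1 := by simpa [hx] using hDx x
  have hJx : ‖NormedSpace.inclusionInDoubleDual ℝ X x‖ = 1 :=
    ((NormedSpace.inclusionInDoubleDualLi ℝ (E := X)).norm_map x).trans hx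
  refine hsep (D x) (hD x).le hDxx
    (hsm.mem_closure_convexHull hJx (hD x) hDxx (fun n => (hD _).le) ?_)
  -- Squeeze: `1 - ‖u n - x‖ ≤ D (u n) x ≤ 1`.
  have h1 : Tendsto (fun n => 1 - ‖u n - x‖) atTop (𝓝 1) := by
    simpa using (tendsto_iff_norm_sub_tendsto_zero.1 hux).const_sub 1
  have habs : ∀ n y, D (u n) y ≤ ‖y‖ := fun n y => by
    have := (D (u n)).le_of_opNorm_le (hD _).le y
    rw [one_mul, Real.norm_eq_abs] at this
    exact (le_abs_self _).trans this
  refine tendsto_of_tendsto_of_tendsto_of_le_of_le h1 tendsto_const_nhds (fun n => ?_)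
    fun n => (habs n x).trans_eq hx
  have h2 := habs n (u n - x)
  have h3 : D (u n) (u n) = 1 := by simpa [hu] using hDx (u n)
  rw [map_sub, h3] at h2
  change 1 - ‖u n - x‖ ≤ D (u n) x
  linarith
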